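/- Let $\mathbb X\subset\mathbb R^d$ be a Borel set, let $\mathbb U\subset\mathbb R^m$ be compact, let $c:\mathbb X\times\mathbb U\to\mathbb R$ be bounded and continuous, and let $\mathcal T$ and $\mathcal T_n$ $(n\in\mathbb N)$ be stochastic kernels from $\mathbb X\times\mathbb U$ to $\mathbb X$. An admissible policy is a sequence $\gamma=(\gamma_t)_{t\ge0}$ of measurable functions giving the actions $U_t=\gamma_t(X_0,\dots,X_t,U_0,\dots,U_{t-1})$; it is stationary if $U_t=\gamma(X_t)$ for all $t$, with one measurable $\gamma:\mathbb X\to\mathbb U$. Fix an initial state $x_0\in\mathbb X$ and a class $\Gamma$ of admissible policies that contains all stationary ones (for instance all stationary policies, or all admissible policies). Set $$J_\infty(\mathcal T,\gamma)=\limsup_{N\to\infty}\frac1N E^{\mathcal T,\gamma}_{x_0}\Big[\sum_{t=0}^{N-1}c(X_t,U_t)\Big],\qquad J^*_\infty(\mathcal T)=\inf_{\gamma\in\Gamma}J_\infty(\mathcal T,\gamma),$$ where under $E^{\mathcal T,\gamma}_{x_0}$ the process starts at $X_0=x_0$ and $X_{t+1}\sim\mathcal T(\cdot\,|X_t,U_t)$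 given the past. Assume the following. 1. The maps $(x,u)\mapsto\mathcal T(\cdot|x,u)$ and $(x,u)\mapsto\mathcal T_n(\cdot|x,u)$, for every $n$, are weakly continuous, and $\mathcal T_n(\cdot|x_n,u_n)\to\mathcal T(\cdot|x,u)$ weakly whenever $(x_n,u_n)\to(x,u)$ in $\mathbb X\times\mathbb U$. 2. For every stationary policy $\gamma$, the Markov chains on $\mathbb X$ with transition kernels $\mathcal T(\cdot|x,\gamma(x))$ and $\mathcal T_n(\cdot|x,\gamma(x))$, $n\in\mathbb N$, are positive Harris recurrent: there is a nonzero $\sigma$-finite measure $\varphi$ such that every measurable set $A$ with $\varphi(A)>0$ is visited infinitely often almost surely from every initial state, and an invariant probability measure exists. (The invariant probability measures, which are then unique, are denoted by $\pi^\gamma$ and $\pi^\gamma_n$.) 3. The families $\{\pi^\gamma\}_\gamma$ and $\{\pi_n^\gamma\}_{\gamma,n}$, where $\gamma$ ranges over all stationary policies, are tight. 4. There are stationary policies $\gamma^*$ and $\gamma_n^*$ with $J_\infty(\mathcal T,\gamma^*)=J_\infty^*(\mathcal T)$ and $J_\infty(\mathcal T_n,\gamma_n^*)=J_\infty^*(\mathcal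 T_n)$ for every $n$, such that $\gamma^*$ is continuous and the family $\{\gamma_n^*\}_n$ is equicontinuous. Then, as $n\to\infty$, $$J_\infty^*(\mathcal T_n)\to J_\infty^*(\mathcal T)\qquad\text{and}\qquad J_\infty(\mathcal T,\gamma_n^*)\to J_\infty^*(\mathcal T).$$ -/

import Mathlib

open MeasureTheory ProbabilityTheory Filter Topology

noncomputable section

namespace AvgCost

section Policies

variable (X U : Type*) [MeasurableSpace X] [MeasurableSpace U]

/-- An admissible policy: a sequence of measurable control functions. The action `U₀` is a
function of `X₀`, and `U_{t+1}` is a function of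
`((X₀, U₀), …, (X_t, U_t))` and `X_{t+1}`. -/
structure AdmissiblePolicy where
  init : X → U
  measurable_init : Measurable init
  step : (t : ℕ) → (Finset.Iic t → X × U) × X → U
  measurable_step : ∀ t, Measurable (step t)

/-- A stationary (deterministic, Markov, time-homogeneous) policy: a measurable map from states
to actions, used as `U_t = γ (X_t)`. -/
abbrev StationaryPolicy := {γ : X → U // Measurable γ}

end Policies

variable {X U : Type*} [MeasurableSpace X] [MeasurableSpace U]

/-- A stationary policy, seen as an admissible policy. -/
def StationaryPolicy.toAdmissible (γ : StationaryPolicy X U) : AdmissiblePolicy X U where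
  init := γ.1
  measurable_init := γ.2
  step _ h := γ.1 h.2
  measurable_step _ := γ.2.comp measurable_snd

/-- The conditional law of `(X_{t+1}, U_{t+1})` given `((X₀, U₀), …, (X_t, U_t)) = h` under the
transition kernel `T` and the policy `γ`: the next state is drawn from `T(· | x_t, u_t)` and the
next action is `γ_{t+1}(h, X_{t+1})`. -/
def stepKernel (T : Kernel (X × U) X) (γ : AdmissiblePolicy X U) (t : ℕ) :
    Kernel (Finset.Iic t → X × U) (X × U) :=
  (Kernel.id ×ₖ T.comap (fun h : Finset.Iic t → X × U => h ⟨t, Finset.mem_Iic.2 le_rfl⟩)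
    (measurable_pi_apply _)).map (fun p => (p.2, γ.step t p))

instance (T : Kernel (X × U) X) [IsMarkovKernel T] (γ : AdmissiblePolicy X U) (t : ℕ) :
    IsMarkovKernel (stepKernel T γ t) :=
  Kernel.IsMarkovKernel.map _ (measurable_snd.prodMk (γ.measurable_step t))

/-- The law of the state-action process `(X_t, U_t)_{t ≥ 0}` with initial state `x₀`. -/
def processLaw (T : Kernel (X × U) X) [IsMarkovKernel T] (γ : AdmissiblePolicy X U) (x₀ : X) :
    Measure (ℕ → X × U) :=
  Kernel.traj (X := fun _ => X × U) (stepKernel T γ) 0 (fun _ => (x₀, γ.init x₀))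

/-- The infinite-horizon average expected cost
`limsup_N (1/N) E[∑_{t < N} c(X_t, U_t)]` of the policy `γ` under `T`, started at `x₀`.
It is used for bounded measurable costs `c` only. -/
def avgCost (T : Kernel (X × U) X) [IsMarkovKernel T] (c : X × U → ℝ) (x₀ : X)
    (γ : AdmissiblePolicy X U) : ℝ :=
  limsup (fun N : ℕ => (1 / (N : ℝ)) *
    ∫ ω, ∑ t ∈ Finset.range N, c (ω t) ∂(processLaw T γ x₀)) atTop

/-- The optimal average cost over a class `Γ` of policies. -/
def optCost (T : Kernel (X × U) X) [IsMarkovKernel T] (c : X × U → ℝ) (x₀ : X)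
    (Γ : Set (AdmissiblePolicy X U)) : ℝ :=
  ⨅ γ : Γ, avgCost T c x₀ γ

/-- The transition kernel `T(· | x, γ(x))` of the state process under a stationary policy. -/
def closedLoop (T : Kernel (X × U) X) (γ : StationaryPolicy X U) : Kernel X X :=
  T.comap (fun x => (x, γ.1 x)) (measurable_id.prodMk γ.2)

instance (T : Kernel (X × U) X) [IsMarkovKernel T] (γ : StationaryPolicy X U) :
    IsMarkovKernel (closedLoop T γ) := by
  unfold closedLoop; infer_instance

/-- The law of the time-homogeneous Markov chain with transition kernel `P` started at `x`. -/
def chainLaw (P : Kernel X X) [IsMarkovKernel P] (x : X) : Measure (ℕ → X) :=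
  Kernel.traj (X := fun _ => X)
    (fun t => P.comap (fun h : Finset.Iic t → X => h ⟨t, Finset.mem_Iic.2 le_rfl⟩)
      (measurable_pi_apply _)) 0 (fun _ => x)

/-- Positive Harris recurrence: there is a nontrivial σ-finite measure `φ` such that, from every
initial state, every measurable set of positive `φ`-measure is almost surely visited infinitely
often, and the chain has an invariant probability measure. -/
def IsPositiveHarris (P : Kernel X X) [IsMarkovKernel P] : Prop :=
  (∃ φ : Measure X, SigmaFinite φ ∧ φ ≠ 0 ∧
    ∀ A : Set X, MeasurableSet A → 0 < φ A →
      ∀ x : X, ∀ᵐ ω ∂(chainLaw P x), ∃ᶠ t in atTop, ω t ∈ A) ∧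
  ∃ π : Measure X, IsProbabilityMeasure π ∧ P.Invariant π

/-- All probability measures that are invariant for `T` under some stationary policy. -/
def invariantMeasures (T : Kernel (X × U) X) : Set (Measure X) :=
  {π | IsProbabilityMeasure π ∧ ∃ γ : StationaryPolicy X U, (closedLoop T γ).Invariant π}

/-- The value of a Markov kernel at a point, in the space of probability measures with the
topology of weak convergence. -/
def kernelAt {Y : Type*} [MeasurableSpace Y] (T : Kernel Y X) [IsMarkovKernel T] (y : Y) :
    ProbabilityMeasure X :=
  ⟨T y, inferInstance⟩

end AvgCost

end

/-! Under a stationary policy `γ` the state is a positive Harris chain, and its average cost from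
any initial state is `∫ c(y, γ(y)) dπ` with `π` the invariant law (`avgCost_stationary`). The
problem thus becomes the continuity of `π` and of this integral in the kernel and the policy.

The ergodic theorem `IsPositiveHarris.tendsto_cesaro` behind this formula avoids splitting and
periodicity. The limsup `h` of the Cesàro averages of `P^t f` is bounded and subharmonic, so
`h(X_t)` is a convergent submartingale. If `h` exceeds `a` at one point, recurrence keeps almost
every path eventually in `{h > b}` for each `b < a`, and invariance gives this set full `π`-mass.
The maximal ergodic inequality for `f - b` then yields `∫ f dπ ≥ b`. Uniqueness of `π` follows.

For continuity (`tendsto_avgCost`), tightness gives limit points of the invariant laws; continuous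
convergence, which is uniform on compact sets, makes each of them invariant for the limit chain, and
uniqueness identifies it. Equicontinuity and compactness of the action space give a continuous limit
`γ` of the policies `γn` along any ultrafilter. Passing to the limit in `J(Tn, γn) ≤ J(Tn, γs)`
gives `J(T, γ) ≤ J(T, γs)`, so `γ` is optimal for `T`; both claimed limits equal `J(T, γ)`.
Ultrafilters replace the extraction of subsequences. -/

namespace AvgCost

variable {X U : Type*} [MeasurableSpace X] [MeasurableSpace U]

/-! ### Bounded measurable functions and the transition operator -/

/-- Bounded measurable real functions. -/
structure BddMeasurable {E : Type*} [MeasurableSpace E] (f : E → ℝ) : Prop where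
  measurable : Measurable f
  bounded : ∃ C : ℝ, ∀ x, |f x| ≤ C

namespace BddMeasurable

variable {E F : Type*} [MeasurableSpace E] [MeasurableSpace F] {f g : E → ℝ}

lemma integrable (hf : BddMeasurable f) (μ : Measure E) [IsFiniteMeasure μ] :
    Integrable f μ := by
  obtain ⟨C, hC⟩ := hf.bounded
  exact Integrable.of_bound hf.measurable.aestronglyMeasurable C (ae_of_all _ hC)

lemma comp (hf : BddMeasurable f) {φ : F → E} (hφ : Measurable φ) :
    BddMeasurable (fun x => f (φ x)) :=
  ⟨hf.measurable.comp hφ, hf.bounded.imp fun _ hC _ => hC _⟩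

lemma const (a : ℝ) : BddMeasurable (fun _ : E => a) := ⟨measurable_const, |a|, fun _ => le_rfl⟩

lemma add (hf : BddMeasurable f) (hg : BddMeasurable g) : BddMeasurable (fun x => f x + g x) := by
  obtain ⟨C, hC⟩ := hf.bounded
  obtain ⟨D, hD⟩ := hg.bounded
  exact ⟨hf.measurable.add hg.measurable, C + D,
    fun x => (abs_add_le _ _).trans (add_le_add (hC x) (hD x))⟩

lemma neg (hf : BddMeasurable f) : BddMeasurable (fun x => -f x) :=
  ⟨hf.measurable.neg, hf.bounded.imp fun _ hC x => by rw [abs_neg]; exact hC x⟩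

lemma sub (hf : BddMeasurable f) (hg : BddMeasurable g) : BddMeasurable (fun x => f x - g x) := by
  simpa only [sub_eq_add_neg] using hf.add hg.neg

lemma const_mul (hf : BddMeasurable f) (a : ℝ) : BddMeasurable (fun x => a * f x) := by
  obtain ⟨C, hC⟩ := hf.bounded
  refine ⟨hf.measurable.const_mul a, |a| * C, fun x => ?_⟩
  rw [abs_mul]
  exact mul_le_mul_of_nonneg_left (hC x) (abs_nonneg a)

lemma max (hf : BddMeasurable f) (hg : BddMeasurable g) :
    BddMeasurable (fun x => f x ⊔ g x) := by
  obtain ⟨C, hC⟩ := hf.bounded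
  obtain ⟨D, hD⟩ := hg.bounded
  exact ⟨hf.measurable.max hg.measurable, C ⊔ D,
    fun x => abs_max_le_max_abs_abs.trans (max_le_max (hC x) (hD x))⟩

lemma sum {ι : Type*} (s : Finset ι) {f : ι → E → ℝ} (hf : ∀ i, BddMeasurable (f i)) :
    BddMeasurable (fun x => ∑ i ∈ s, f i x) := by
  classical
  induction s using Finset.induction_on with
  | empty => simpa using const (E := E) 0
  | insert i s hi ih => simpa only [Finset.sum_insert hi] using (hf i).add ih

lemma indicator_one {A : Set E} (hA : MeasurableSet A) :
    BddMeasurable (A.indicator (fun _ => (1 : ℝ))) := by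
  refine ⟨measurable_const.indicator hA, 1, fun x => ?_⟩
  by_cases hx : x ∈ A <;> simp [hx]

end BddMeasurable

/-- The action of a kernel on functions: `transition P f x = ∫ f dP(x, ·)`. -/
noncomputable def transition {Y : Type*} [MeasurableSpace Y] (P : Kernel Y X) (f : X → ℝ) :
    Y → ℝ := fun x => ∫ y, f y ∂P x

lemma BddMeasurable.transition {Y : Type*} [MeasurableSpace Y] (P : Kernel Y X) [IsMarkovKernel P]
    {f : X → ℝ} (hf : BddMeasurable f) : BddMeasurable (transition P f) := by
  obtain ⟨C, hC⟩ := hf.bounded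
  refine ⟨(hf.measurable.stronglyMeasurable.integral_kernel (κ := P)).measurable, C, fun x => ?_⟩
  have := norm_integral_le_of_norm_le_const (μ := P x) (f := f) (C := C) (ae_of_all _ hC)
  simpa [AvgCost.transition] using this

section Transition

variable (P : Kernel X X) [IsMarkovKernel P]

lemma BddMeasurable.iterate_transition {f : X → ℝ} (hf : BddMeasurable f) (t : ℕ) :
    BddMeasurable ((AvgCost.transition P)^[t] f) := by
  induction t with
  | zero => exact hf
  | succ t ih => rw [Function.iterate_succ_apply']; exact ih.transition P

lemma transition_mono {f g : X → ℝ} (hf : BddMeasurable f) (hg : BddMeasurable g)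
    (h : ∀ x, f x ≤ g x) (x : X) : transition P f x ≤ transition P g x :=
  integral_mono (hf.integrable _) (hg.integrable _) h

lemma abs_iterate_transition_le {f : X → ℝ} {C : ℝ} (hC : ∀ x, |f x| ≤ C)
    (t : ℕ) (x : X) : |(transition P)^[t] f x| ≤ C := by
  induction t generalizing x with
  | zero => exact hC x
  | succ t ih =>
    rw [Function.iterate_succ_apply']
    have := norm_integral_le_of_norm_le_const (μ := P x) (f := (transition P)^[t] f) (C := C)
      (ae_of_all _ ih)
    simpa [transition] using this

lemma integral_transition {f : X → ℝ} (hf : BddMeasurable f) (μ : Measure X)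
    [IsProbabilityMeasure μ] : ∫ x, transition P f x ∂μ = ∫ x, f x ∂(P ∘ₘ μ) := by
  rw [Measure.comp_eq_comp_const_apply, Kernel.integral_comp]
  · simp [transition]
  · rw [← Measure.comp_eq_comp_const_apply]
    exact hf.integrable _

lemma integral_transition_of_invariant {f : X → ℝ} (hf : BddMeasurable f) {π : Measure X}
    [IsProbabilityMeasure π] (hπ : P.Invariant π) :
    ∫ x, transition P f x ∂π = ∫ x, f x ∂π := by
  rw [integral_transition P hf, hπ.def]

lemma integral_iterate_transition_of_invariant {f : X → ℝ} (hf : BddMeasurable f) {π : Measure X}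
    [IsProbabilityMeasure π] (hπ : P.Invariant π) (t : ℕ) :
    ∫ x, (transition P)^[t] f x ∂π = ∫ x, f x ∂π := by
  induction t with
  | zero => rfl
  | succ t ih =>
    rw [Function.iterate_succ_apply', integral_transition_of_invariant P
      (hf.iterate_transition P t) hπ, ih]

end Transition

/-! ### Marginals of trajectory measures -/

section Trajectory

variable {E : Type*} [MeasurableSpace E]
  (κ : (t : ℕ) → Kernel (Finset.Iic t → E) E) [∀ t, IsMarkovKernel (κ t)]

lemma integral_traj_eval_succ (t : ℕ) (h : Finset.Iic t → E) {g : E → ℝ} (hg : BddMeasurable g) :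
    ∫ ω, g (ω (t + 1)) ∂(Kernel.traj (X := fun _ => E) κ t h) = transition (κ t) g h := by
  have h1 := DFunLike.congr_fun
    (Kernel.map_traj_succ_self (X := fun _ => E) (κ := κ) (a := t)) h
  rw [Kernel.map_apply _ (measurable_pi_apply _)] at h1
  rw [transition, ← h1, integral_map (measurable_pi_apply _).aemeasurable
    hg.measurable.aestronglyMeasurable]

/-- Tower property: restarting the trajectory from its own history at time `t` does not change its
law, and the next coordinate then has law `κ t`. -/
lemma integral_traj_succ (h₀ : Finset.Iic 0 → E) (t : ℕ) {g : E → ℝ} (hg : BddMeasurable g) :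
    ∫ ω, g (ω (t + 1)) ∂(Kernel.traj (X := fun _ => E) κ 0 h₀) =
      ∫ ω, transition (κ t) g (Preorder.frestrictLe t ω)
        ∂(Kernel.traj (X := fun _ => E) κ 0 h₀) := by
  have hi : Integrable (fun ω : ℕ → E => g (ω (t + 1))) (Kernel.traj (X := fun _ => E) κ 0 h₀) :=
    (hg.comp (measurable_pi_apply (t + 1))).integrable _
  rw [← Kernel.integral_traj_partialTraj (zero_le (a := t)) hi]
  rw [integral_congr_ae (ae_of_all _ fun h => integral_traj_eval_succ κ t h hg),
    ← Kernel.traj_map_frestrictLe_apply, integral_map]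
  · exact (Preorder.measurable_frestrictLe t).aemeasurable
  · exact (hg.transition (κ t)).measurable.aestronglyMeasurable

lemma integral_traj_zero (h₀ : Finset.Iic 0 → E) {g : E → ℝ} (hg : BddMeasurable g) :
    ∫ ω, g (ω 0) ∂(Kernel.traj (X := fun _ => E) κ 0 h₀) = g (h₀ ⟨0, Finset.mem_Iic.2 le_rfl⟩) := by
  rw [Kernel.integral_traj (X := fun _ => E) (f := fun ω : ℕ → E => g (ω 0)) h₀
    (hg.measurable.comp (measurable_pi_apply 0)).aestronglyMeasurable]
  simp [Function.updateFinset]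

end Trajectory

section Chain

variable (P : Kernel X X) [IsMarkovKernel P]

instance (x : X) : IsProbabilityMeasure (chainLaw P x) := by
  unfold chainLaw; infer_instance

lemma integral_chainLaw_succ (x : X) (t : ℕ) {g : X → ℝ} (hg : BddMeasurable g) :
    ∫ ω, g (ω (t + 1)) ∂(chainLaw P x) = ∫ ω, transition P g (ω t) ∂(chainLaw P x) :=
  integral_traj_succ _ _ t hg

lemma integral_chainLaw (x : X) (t : ℕ) {g : X → ℝ} (hg : BddMeasurable g) :
    ∫ ω, g (ω t) ∂(chainLaw P x) = (transition P)^[t] g x := by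
  induction t generalizing g with
  | zero => exact integral_traj_zero _ _ hg
  | succ t ih =>
    rw [integral_chainLaw_succ P x t hg, ih (hg.transition P), ← Function.iterate_succ_apply]

/-- By the Markov property, the conditional expectation of `h (ω (t + 1))` given the past is
`transition P h (ω t)`. -/
lemma submartingale_chainLaw {h : X → ℝ} (hh : BddMeasurable h)
    (hsub : ∀ x, h x ≤ transition P h x) (x : X) :
    Submartingale (fun t (ω : ℕ → X) => h (ω t)) (Filtration.piLE (X := fun _ => X))
      (chainLaw P x) := by
  refine submartingale_nat (fun t => ?_) (fun t => (hh.comp (measurable_pi_apply t)).integrable _)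
    (fun t => ?_)
  · rw [Filtration.piLE_eq_comap_frestrictLe]
    have : Measurable (fun p : Finset.Iic t → X => h (p ⟨t, Finset.mem_Iic.2 le_rfl⟩)) :=
      hh.measurable.comp (measurable_pi_apply _)
    exact (this.comp (comap_measurable (Preorder.frestrictLe (π := fun _ => X) t))).stronglyMeasurable
  · have hi : Integrable (fun ω : ℕ → X => h (ω (t + 1))) (chainLaw P x) :=
      (hh.comp (measurable_pi_apply (t + 1))).integrable _
    have := Kernel.condExp_traj (zero_le (a := t)) hi
    filter_upwards [this] with ω hω
    refine (hsub (ω t)).trans (le_of_eq ?_)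
    refine Eq.trans ?_ hω.symm
    rw [integral_traj_eval_succ _ t _ hh]
    rfl

lemma ae_exists_tendsto_of_le_transition {h : X → ℝ} (hh : BddMeasurable h)
    (hsub : ∀ x, h x ≤ transition P h x) (x : X) :
    ∀ᵐ ω ∂(chainLaw P x), ∃ z, Tendsto (fun t => h (ω t)) atTop (𝓝 z) := by
  obtain ⟨C, hC⟩ := hh.bounded
  refine (submartingale_chainLaw P hh hsub x).exists_ae_tendsto_of_bdd (R := C.toNNReal)
    fun t => ?_
  have := eLpNorm_le_of_ae_bound (p := 1) (μ := chainLaw P x) (f := fun ω : ℕ → X => h (ω t))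
    (C := C) (ae_of_all _ fun ω => hC _)
  simpa [ENNReal.ofReal] using this

lemma le_integral_chainLaw {h : X → ℝ} (hh : BddMeasurable h)
    (hsub : ∀ x, h x ≤ transition P h x) (x : X) (t : ℕ) :
    h x ≤ ∫ ω, h (ω t) ∂(chainLaw P x) := by
  induction t with
  | zero => rw [integral_chainLaw P x 0 hh]; rfl
  | succ t ih =>
    rw [integral_chainLaw_succ P x t hh]
    exact ih.trans (integral_mono ((hh.comp (measurable_pi_apply t)).integrable _)
      (((hh.transition P).comp (measurable_pi_apply t)).integrable _) fun ω => hsub _)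

end Chain

/-! ### The ergodic theorem for positive Harris chains -/

section Harris

variable (P : Kernel X X) [IsMarkovKernel P]

/-- A bounded subharmonic function that is below `q` on a set visited infinitely often is below
`q` everywhere. -/
lemma le_of_recurrent {φ : Measure X}
    (hrec : ∀ A : Set X, MeasurableSet A → 0 < φ A →
      ∀ x : X, ∀ᵐ ω ∂(chainLaw P x), ∃ᶠ t in atTop, ω t ∈ A)
    {h : X → ℝ} (hh : BddMeasurable h) (hsub : ∀ x, h x ≤ transition P h x) {q : ℝ}
    (hq : 0 < φ {x | h x < q}) (x : X) : h x ≤ q := by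
  have hm : BddMeasurable (fun x => h x ⊔ q) := hh.max (.const q)
  obtain ⟨C, hC⟩ := hm.bounded
  -- Along almost every path `h` converges and is infinitely often below `q`, so its limit is at
  -- most `q`; truncating from below at `q` makes the limit exactly `q`.
  have hlim : Tendsto (fun t => ∫ ω, h (ω t) ⊔ q ∂(chainLaw P x)) atTop
      (𝓝 (∫ _, q ∂(chainLaw P x))) := by
    refine tendsto_integral_of_dominated_convergence (fun _ => C)
      (fun t => (hm.comp (measurable_pi_apply t)).measurable.aestronglyMeasurable)
      (integrable_const _) (fun t => ae_of_all _ fun ω => hC _) ?_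
    filter_upwards [ae_exists_tendsto_of_le_transition P hh hsub x,
      hrec _ (measurableSet_lt hh.measurable measurable_const) hq x] with ω ⟨z, hz⟩ hfr
    have hzq : z ≤ q := le_of_tendsto_of_frequently hz (hfr.mono fun t ht => ht.le)
    have := hz.max (tendsto_const_nhds (x := q))
    rwa [max_eq_right hzq] at this
  simp only [integral_const, probReal_univ, smul_eq_mul, one_mul] at hlim
  refine ge_of_tendsto' hlim fun t => (le_integral_chainLaw P hh hsub x t).trans ?_
  exact integral_mono ((hh.comp (measurable_pi_apply t)).integrable _)
    ((hm.comp (measurable_pi_apply t)).integrable _) fun ω => le_max_left _ _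

/-- If a bounded subharmonic function exceeds `a` somewhere, then along almost every path it is
eventually above every `b < a`. -/
lemma eventually_lt_of_recurrent {φ : Measure X} (hφ : φ ≠ 0)
    (hrec : ∀ A : Set X, MeasurableSet A → 0 < φ A →
      ∀ x : X, ∀ᵐ ω ∂(chainLaw P x), ∃ᶠ t in atTop, ω t ∈ A)
    {h : X → ℝ} (hh : BddMeasurable h) (hsub : ∀ x, h x ≤ transition P h x) {a b : ℝ}
    (hba : b < a) {x₀ : X} (ha : a < h x₀) (x : X) :
    ∀ᵐ ω ∂(chainLaw P x), ∀ᶠ t in atTop, b < h (ω t) := by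
  have h0 : φ {x | h x < a} = 0 := by
    by_contra hne
    exact absurd (le_of_recurrent P hrec hh hsub (pos_iff_ne_zero.2 hne) x₀) (not_le.2 ha)
  -- Since `φ` is nonzero and does not charge `{h < a}`, the complement is visited infinitely often,
  -- which bounds the limit of `h` along paths from below by `a`.
  have hpos : 0 < φ {x | a ≤ h x} := by
    rw [pos_iff_ne_zero]
    intro h1
    apply hφ
    rw [← Measure.measure_univ_eq_zero]
    refine measure_mono_null (fun y _ => ?_) (measure_union_null h0 h1)
    exact lt_or_ge (h y) a
  filter_upwards [ae_exists_tendsto_of_le_transition P hh hsub x,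
    hrec _ (measurableSet_le measurable_const hh.measurable) hpos x] with ω ⟨z, hz⟩ hfr
  have haz : a ≤ z := ge_of_tendsto_of_frequently hz (hfr.mono fun t ht => ht)
  exact hz.eventually_const_lt (hba.trans_le haz)

/-- An invariant probability measure gives full mass to a measurable set that almost every path
eventually stays in. -/
lemma ae_mem_of_eventually {π : Measure X} [IsProbabilityMeasure π] (hπ : P.Invariant π)
    {A : Set X} (hA : MeasurableSet A)
    (hev : ∀ x, ∀ᵐ ω ∂(chainLaw P x), ∀ᶠ t in atTop, ω t ∈ A) : ∀ᵐ x ∂π, x ∈ A := by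
  have hi := BddMeasurable.indicator_one hA
  have hbd : ∀ x, |A.indicator (fun _ => (1 : ℝ)) x| ≤ 1 := fun x => by
    by_cases hx : x ∈ A <;> simp [hx]
  have hpt : ∀ x, Tendsto (fun t => (transition P)^[t] (A.indicator fun _ => (1 : ℝ)) x) atTop
      (𝓝 1) := by
    intro x
    have : Tendsto (fun t => ∫ ω, A.indicator (fun _ => (1 : ℝ)) (ω t) ∂(chainLaw P x)) atTop
        (𝓝 (∫ _, 1 ∂(chainLaw P x))) := by
      refine tendsto_integral_of_dominated_convergence (fun _ => 1)
        (fun t => (hi.comp (measurable_pi_apply t)).measurable.aestronglyMeasurable)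
        (integrable_const _) (fun t => ae_of_all _ fun ω => hbd _) ?_
      filter_upwards [hev x] with ω hω
      refine tendsto_const_nhds.congr' ?_
      filter_upwards [hω] with t ht
      simp [ht]
    simpa [integral_chainLaw P x _ hi] using this
  -- By invariance these integrals all equal the mass of `A`, so their limit determines it.
  have hlim : Tendsto (fun t => ∫ x, (transition P)^[t] (A.indicator fun _ => (1 : ℝ)) x ∂π) atTop
      (𝓝 (∫ _, 1 ∂π)) :=
    tendsto_integral_of_dominated_convergence (fun _ => 1)
      (fun t => (hi.iterate_transition P t).measurable.aestronglyMeasurable)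
      (integrable_const _) (fun t => ae_of_all _ fun x => abs_iterate_transition_le P hbd t x)
      (ae_of_all _ hpt)
  simp only [integral_iterate_transition_of_invariant P hi hπ, integral_const, probReal_univ,
    smul_eq_mul, one_mul, integral_indicator_const _ hA] at hlim
  have h1 : π.real A = 1 := by
    simpa using tendsto_nhds_unique tendsto_const_nhds hlim
  have h2 : π A = 1 := by
    rw [measureReal_def] at h1
    rw [← ENNReal.ofReal_toReal (measure_ne_top π A), h1, ENNReal.ofReal_one]
  rw [← prob_compl_eq_zero_iff hA] at h2
  exact h2

/-- The value of the optimal stopping problem with running reward `f`, by backward recursion. -/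
noncomputable def stoppingValue (f : X → ℝ) : ℕ → X → ℝ
  | 0 => fun _ => 0
  | n + 1 => fun x => (f x + transition P (stoppingValue f n) x) ⊔ 0

/-- The partial sums `∑_{t < n} P^t f`. -/
noncomputable def potential (f : X → ℝ) (n : ℕ) (x : X) : ℝ :=
  ∑ t ∈ Finset.range n, (transition P)^[t] f x

variable {P}

lemma BddMeasurable.potential {f : X → ℝ} (hf : BddMeasurable f) (n : ℕ) :
    BddMeasurable (potential P f n) :=
  .sum _ fun t => hf.iterate_transition P t

lemma transition_potential {f : X → ℝ} (hf : BddMeasurable f) (n : ℕ) (x : X) :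
    transition P (potential P f n) x = ∑ t ∈ Finset.range n, (transition P)^[t + 1] f x := by
  unfold transition potential
  rw [integral_finsetSum _ fun t _ => (hf.iterate_transition P t).integrable _]
  simp only [Function.iterate_succ_apply']
  rfl

lemma potential_succ {f : X → ℝ} (hf : BddMeasurable f) (n : ℕ) (x : X) :
    potential P f (n + 1) x = f x + transition P (potential P f n) x := by
  rw [transition_potential hf, potential, Finset.sum_range_succ', add_comm]
  rfl

lemma BddMeasurable.stoppingValue {f : X → ℝ} (hf : BddMeasurable f) (n : ℕ) :
    BddMeasurable (stoppingValue P f n) := by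
  induction n with
  | zero => exact .const 0
  | succ n ih => exact (hf.add (ih.transition P)).max (.const 0)

omit [IsMarkovKernel P] in
lemma stoppingValue_nonneg (f : X → ℝ) (n : ℕ) (x : X) : 0 ≤ stoppingValue P f n x := by
  cases n with
  | zero => exact le_rfl
  | succ n => exact le_max_right _ _

lemma stoppingValue_le_succ {f : X → ℝ} (hf : BddMeasurable f) (n : ℕ) (x : X) :
    stoppingValue P f n x ≤ stoppingValue P f (n + 1) x := by
  induction n generalizing x with
  | zero => exact stoppingValue_nonneg f 1 x
  | succ n ih =>
    exact max_le_max (add_le_add le_rfl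
      (transition_mono P (hf.stoppingValue n) (hf.stoppingValue (n + 1)) ih x)) le_rfl

/-- Never stopping before the horizon is one of the competing rules. -/
lemma potential_le_stoppingValue {f : X → ℝ} (hf : BddMeasurable f) (n : ℕ) (x : X) :
    potential P f n x ≤ stoppingValue P f n x := by
  induction n generalizing x with
  | zero => simp [potential, stoppingValue]
  | succ n ih =>
    rw [potential_succ hf]
    exact (add_le_add le_rfl (transition_mono P (hf.potential n) (hf.stoppingValue n) ih x)).trans
      (le_max_left _ _)

/-- The maximal ergodic inequality. -/
lemma setIntegral_stoppingValue_nonneg {π : Measure X} [IsProbabilityMeasure π]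
    (hπ : P.Invariant π) {f : X → ℝ} (hf : BddMeasurable f) (n : ℕ) :
    0 ≤ ∫ x in {x | 0 < stoppingValue P f n x}, f x ∂π := by
  cases n with
  | zero => simp [stoppingValue]
  | succ n =>
    set A : Set X := {x | 0 < stoppingValue P f (n + 1) x} with hAdef
    have hA : MeasurableSet A := measurableSet_lt measurable_const (hf.stoppingValue _).measurable
    rw [← integral_indicator hA]
    -- On `A` this is an equality by the recursion; off `A` the value at `n + 1` vanishes and the
    -- subtracted term is nonnegative. After integration, invariance and monotonicity in `n` make
    -- the left side nonnegative.
    have hle : ∀ x, stoppingValue P f (n + 1) x - transition P (stoppingValue P f n) x ≤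
        A.indicator f x := by
      intro x
      have h0 : 0 ≤ transition P (stoppingValue P f n) x :=
        integral_nonneg fun y => stoppingValue_nonneg f n y
      by_cases hx : x ∈ A
      · rw [Set.indicator_of_mem hx]
        have hx' : 0 < (f x + transition P (stoppingValue P f n) x) ⊔ 0 := hx
        have h1 : 0 < f x + transition P (stoppingValue P f n) x := by
          rcases lt_max_iff.1 hx' with h | h
          · exact h
          · exact absurd h (lt_irrefl _)
        change (f x + transition P (stoppingValue P f n) x) ⊔ 0 - _ ≤ f x
        rw [max_eq_left h1.le]
        linarith
      · rw [Set.indicator_of_notMem hx]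
        have hx' : stoppingValue P f (n + 1) x ≤ 0 := not_lt.1 hx
        linarith
    have hint := integral_mono (((hf.stoppingValue (n + 1)).sub
      ((hf.stoppingValue n).transition P)).integrable π) ((hf.integrable π).indicator hA) hle
    rw [integral_sub ((hf.stoppingValue (n + 1)).integrable π)
      (((hf.stoppingValue n).transition P).integrable π),
      integral_transition_of_invariant P (hf.stoppingValue n) hπ] at hint
    have hmono := integral_mono ((hf.stoppingValue n).integrable π)
      ((hf.stoppingValue (n + 1)).integrable π) (stoppingValue_le_succ (P := P) hf n)
    linarith

/-- The sets in the maximal inequality increase to a set of full measure, and dominated convergence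
removes the restriction. -/
lemma integral_nonneg_of_potential_pos {π : Measure X} [IsProbabilityMeasure π]
    (hπ : P.Invariant π) {f : X → ℝ} (hf : BddMeasurable f)
    (hpos : ∀ᵐ x ∂π, ∃ n, 0 < potential P f n x) : 0 ≤ ∫ x, f x ∂π := by
  have hA : ∀ n, MeasurableSet {x | 0 < stoppingValue P f n x} := fun n =>
    measurableSet_lt measurable_const (hf.stoppingValue n).measurable
  have hlim : Tendsto (fun n => ∫ x, {x | 0 < stoppingValue P f n x}.indicator f x ∂π) atTop
      (𝓝 (∫ x, f x ∂π)) := by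
    obtain ⟨C, hC⟩ := hf.bounded
    refine tendsto_integral_of_dominated_convergence (fun _ => C)
      (fun n => (hf.measurable.indicator (hA n)).aestronglyMeasurable) (integrable_const _)
      (fun n => ae_of_all _ fun x => (norm_indicator_le_norm_self _ _).trans (hC x)) ?_
    filter_upwards [hpos] with x ⟨n, hn⟩
    refine tendsto_const_nhds.congr' ?_
    filter_upwards [eventually_ge_atTop n] with k hk
    have hmono : Monotone fun n => stoppingValue P f n x :=
      monotone_nat_of_le_succ fun n => stoppingValue_le_succ hf n x
    rw [Set.indicator_of_mem]
    exact (hn.trans_le (potential_le_stoppingValue hf n x)).trans_le (hmono hk)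
  refine ge_of_tendsto' hlim fun n => ?_
  rw [integral_indicator (hA n)]
  exact setIntegral_stoppingValue_nonneg hπ hf n

end Harris

/-! ### Cesàro averages and their limits -/

section Ergodic

variable (P : Kernel X X) [IsMarkovKernel P]

/-- The Cesàro averages `(1 / n) ∑_{t < n} P^t f`. -/
noncomputable def cesaro (f : X → ℝ) (n : ℕ) (x : X) : ℝ := (1 / (n : ℝ)) * potential P f n x

/-- The tail suprema of the Cesàro averages. -/
noncomputable def cesaroSup (f : X → ℝ) (k : ℕ) (x : X) : ℝ := ⨆ i : ℕ, cesaro P f (i + k + 1) x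

variable {P}

lemma BddMeasurable.cesaro {f : X → ℝ} (hf : BddMeasurable f) (n : ℕ) :
    BddMeasurable (cesaro P f n) :=
  (hf.potential n).const_mul _

lemma abs_cesaro_le {f : X → ℝ} {C : ℝ} (hC : ∀ x, |f x| ≤ C) (n : ℕ) (x : X) :
    |cesaro P f n x| ≤ C := by
  have hC0 : 0 ≤ C := (abs_nonneg _).trans (hC x)
  have hs : |potential P f n x| ≤ n * C := by
    refine (Finset.abs_sum_le_sum_abs _ _).trans ?_
    refine (Finset.sum_le_card_nsmul _ _ C fun t _ => abs_iterate_transition_le P hC t x).trans ?_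
    simp
  rcases Nat.eq_zero_or_pos n with rfl | hn
  · simpa [cesaro] using hC0
  · have hn' : (0 : ℝ) < n := by exact_mod_cast hn
    rw [cesaro, abs_mul, abs_of_pos (by positivity), one_div, inv_mul_le_iff₀ hn']
    exact hs

/-- Applying `P` to the partial sum shifts it, so only the end terms `P^n f - f`, of size at most `2
* C`, survive in the difference. -/
lemma cesaro_le_transition {f : X → ℝ} (hf : BddMeasurable f) {C : ℝ} (hC : ∀ x, |f x| ≤ C)
    (n : ℕ) (x : X) :
    cesaro P f n x - 2 * C / n ≤ transition P (cesaro P f n) x := by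
  have h1 : transition P (cesaro P f n) x = (1 / (n : ℝ)) * transition P (potential P f n) x :=
    integral_const_mul _ _
  have h2 : transition P (potential P f n) x = potential P f n x + (transition P)^[n] f x - f x := by
    have h3 := Finset.sum_range_succ (fun t => (transition P)^[t] f x) n
    have h4 := potential_succ (P := P) hf n x
    rw [potential] at h4
    rw [potential]
    linarith
  rw [h1, h2, cesaro]
  have h5 := (abs_le.1 (abs_iterate_transition_le P hC n x)).1
  have h6 := (abs_le.1 (hC x)).2
  have h7 : (1 / (n : ℝ)) * (-(2 * C)) ≤ 1 / (n : ℝ) * ((transition P)^[n] f x - f x) :=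
    mul_le_mul_of_nonneg_left (by linarith) (by positivity)
  have h8 : 2 * C / (n : ℝ) = 1 / (n : ℝ) * (2 * C) := by ring
  rw [h8]
  linarith

lemma bddAbove_cesaro {f : X → ℝ} (hf : BddMeasurable f) (k : ℕ) (x : X) :
    BddAbove (Set.range fun i : ℕ => cesaro P f (i + k + 1) x) := by
  obtain ⟨C, hC⟩ := hf.bounded
  exact ⟨C, by rintro _ ⟨i, rfl⟩; exact (abs_le.1 (abs_cesaro_le hC _ x)).2⟩

lemma cesaro_le_cesaroSup {f : X → ℝ} (hf : BddMeasurable f) {k n : ℕ} (hkn : k < n) (x : X) :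
    cesaro P f n x ≤ cesaroSup P f k x := by
  have := le_ciSup (bddAbove_cesaro (P := P) hf k x) (n - (k + 1))
  simp only [show n - (k + 1) + k + 1 = n by omega] at this
  exact this

lemma abs_cesaroSup_le {f : X → ℝ} (hf : BddMeasurable f) {C : ℝ} (hC : ∀ x, |f x| ≤ C) (k : ℕ)
    (x : X) : |cesaroSup P f k x| ≤ C := by
  refine abs_le.2 ⟨?_, ciSup_le fun i => (abs_le.1 (abs_cesaro_le hC _ x)).2⟩
  exact (abs_le.1 (abs_cesaro_le hC (k + 1) x)).1.trans (cesaro_le_cesaroSup hf k.lt_succ_self x)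

lemma BddMeasurable.cesaroSup {f : X → ℝ} (hf : BddMeasurable f) (k : ℕ) :
    BddMeasurable (cesaroSup P f k) := by
  obtain ⟨C, hC⟩ := hf.bounded
  exact ⟨Measurable.iSup fun i => (hf.cesaro _).measurable, C, abs_cesaroSup_le hf hC k⟩

lemma antitone_cesaroSup {f : X → ℝ} (hf : BddMeasurable f) (x : X) :
    Antitone fun k => cesaroSup P f k x :=
  antitone_nat_of_succ_le fun k => ciSup_le fun i => cesaro_le_cesaroSup hf (by omega) x

/-- The defect is uniform over the averages in the supremum and vanishes as `k → ∞`, which makes the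
limsup subharmonic. -/
lemma cesaroSup_le_transition {f : X → ℝ} (hf : BddMeasurable f) {C : ℝ} (hC : ∀ x, |f x| ≤ C)
    (k : ℕ) (x : X) :
    cesaroSup P f k x - 2 * C / (k + 1) ≤ transition P (cesaroSup P f k) x := by
  have hC0 : 0 ≤ C := (abs_nonneg _).trans (hC x)
  rw [sub_le_iff_le_add]
  refine ciSup_le fun i => ?_
  have h1 := cesaro_le_transition (P := P) hf hC (i + k + 1) x
  have h2 := transition_mono P (hf.cesaro (i + k + 1)) (hf.cesaroSup k)
    (cesaro_le_cesaroSup (P := P) hf (by omega)) x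
  have h3 : 2 * C / ((i + k + 1 : ℕ) : ℝ) ≤ 2 * C / (k + 1) := by
    apply div_le_div_of_nonneg_left (by linarith) (by positivity)
    push_cast
    have : (0 : ℝ) ≤ i := Nat.cast_nonneg i
    linarith
  linarith

/-- The upper limit of the Cesàro averages is bounded, measurable and subharmonic. -/
lemma exists_limsup_cesaro {f : X → ℝ} (hf : BddMeasurable f) :
    ∃ h : X → ℝ, BddMeasurable h ∧ (∀ x, h x ≤ transition P h x) ∧
      ∀ x, Tendsto (fun k => cesaroSup P f k x) atTop (𝓝 (h x)) := by
  obtain ⟨C, hC⟩ := hf.bounded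
  have hlim : ∀ x, Tendsto (fun k => cesaroSup P f k x) atTop (𝓝 (⨅ k, cesaroSup P f k x)) :=
    fun x => tendsto_atTop_ciInf (antitone_cesaroSup hf x)
      ⟨-C, by rintro _ ⟨k, rfl⟩; exact (abs_le.1 (abs_cesaroSup_le hf hC k x)).1⟩
  refine ⟨fun x => ⨅ k, cesaroSup P f k x, ⟨Measurable.iInf fun k => (hf.cesaroSup k).measurable,
    C, fun x => ?_⟩, fun x => ?_, hlim⟩
  · exact le_of_tendsto' (hlim x).abs fun k => abs_cesaroSup_le hf hC k x
  · have h1 : Tendsto (fun k => transition P (cesaroSup P f k) x) atTop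
        (𝓝 (transition P (fun x => ⨅ k, cesaroSup P f k x) x)) :=
      tendsto_integral_of_dominated_convergence (fun _ => C)
        (fun k => (hf.cesaroSup k).measurable.aestronglyMeasurable) (integrable_const _)
        (fun k => ae_of_all _ fun y => abs_cesaroSup_le hf hC k y) (ae_of_all _ hlim)
    have h2 : Tendsto (fun k : ℕ => cesaroSup P f k x - 2 * C / ((k : ℝ) + 1)) atTop
        (𝓝 ((⨅ k, cesaroSup P f k x) - 0)) := by
      refine (hlim x).sub ?_
      have := (tendsto_one_div_add_atTop_nhds_zero_nat (𝕜 := ℝ)).const_mul (2 * C)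
      simpa [div_eq_mul_inv] using this
    rw [sub_zero] at h2
    exact le_of_tendsto_of_tendsto' h2 h1 fun k => cesaroSup_le_transition hf hC k x

lemma potential_sub_const {f : X → ℝ} (hf : BddMeasurable f) (b : ℝ) (n : ℕ) (x : X) :
    potential P (fun x => f x - b) n x = potential P f n x - n * b := by
  induction n generalizing x with
  | zero => simp [potential]
  | succ n ih =>
    rw [potential_succ (hf.sub (.const b)), potential_succ hf]
    have : transition P (potential P (fun x => f x - b) n) x =
        transition P (potential P f n) x - n * b := by
      unfold transition
      rw [integral_congr_ae (ae_of_all _ ih), integral_sub ((hf.potential n).integrable _)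
        (integrable_const _)]
      simp
    rw [this]
    push_cast
    ring

/-- If the limsup exceeded the mean of `f` at one point, recurrence and invariance would make it
exceed some `b` above that mean `π`-almost everywhere, against the maximal ergodic inequality for `f
- b`. The lower bound comes from `-f`. -/
lemma limsup_cesaro_le {φ : Measure X} (hφ : φ ≠ 0)
    (hrec : ∀ A : Set X, MeasurableSet A → 0 < φ A →
      ∀ x : X, ∀ᵐ ω ∂(chainLaw P x), ∃ᶠ t in atTop, ω t ∈ A)
    {π : Measure X} [IsProbabilityMeasure π] (hπ : P.Invariant π)
    {f : X → ℝ} (hf : BddMeasurable f) (x : X) {a : ℝ} (ha : ∫ y, f y ∂π < a) :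
    ∀ᶠ n in atTop, cesaro P f n x < a := by
  obtain ⟨h, hh, hsub, hlim⟩ := exists_limsup_cesaro (P := P) hf
  suffices hle : h x ≤ ∫ y, f y ∂π by
    obtain ⟨k, hk⟩ := ((hlim x).eventually_lt_const (hle.trans_lt ha)).exists
    filter_upwards [eventually_gt_atTop k] with n hn
    exact (cesaro_le_cesaroSup hf hn x).trans_lt hk
  by_contra! hlt
  obtain ⟨a, hfa, hax⟩ := exists_between hlt
  obtain ⟨b, hfb, hba⟩ := exists_between hfa
  have hae := ae_mem_of_eventually P hπ (measurableSet_lt measurable_const hh.measurable)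
    fun y => eventually_lt_of_recurrent P hφ hrec hh hsub hba hax y
  have hnn := integral_nonneg_of_potential_pos hπ (hf.sub (.const b)) (by
    filter_upwards [hae] with y hy
    -- The tail suprema decrease to `h`, so some average of positive length exceeds `b`; hence a
    -- partial sum of `f - b` is positive.
    have h1 : b < cesaroSup P f 0 y :=
      lt_of_lt_of_le hy ((antitone_cesaroSup hf y).le_of_tendsto (hlim y) 0)
    obtain ⟨i, hi⟩ := exists_lt_of_lt_ciSup h1
    refine ⟨i + 0 + 1, ?_⟩
    have hn : (0 : ℝ) < ((i + 0 + 1 : ℕ) : ℝ) := by positivity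
    rw [potential_sub_const hf]
    rw [cesaro, one_div, lt_inv_mul_iff₀ hn] at hi
    linarith)
  rw [integral_sub (hf.integrable π) (integrable_const _)] at hnn
  simp only [integral_const, probReal_univ, smul_eq_mul, one_mul] at hnn
  linarith

omit [IsMarkovKernel P] in
lemma potential_neg (f : X → ℝ) (n : ℕ) (x : X) :
    potential P (fun x => -f x) n x = -potential P f n x := by
  have h : ∀ t, (transition P)^[t] (fun x => -f x) = fun x => -(transition P)^[t] f x := by
    intro t
    induction t with
    | zero => rfl
    | succ t ih =>
      rw [Function.iterate_succ_apply', Function.iterate_succ_apply', ih]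
      funext y
      exact integral_neg _
  simp [potential, h]

/-- For a positive Harris recurrent chain, the Cesàro averages of the expectations of a bounded
measurable function converge from every initial state to its invariant mean. -/
theorem IsPositiveHarris.tendsto_cesaro (hP : IsPositiveHarris P) {π : Measure X}
    [IsProbabilityMeasure π] (hπ : P.Invariant π) {f : X → ℝ} (hf : BddMeasurable f) (x : X) :
    Tendsto (fun n => cesaro P f n x) atTop (𝓝 (∫ y, f y ∂π)) := by
  obtain ⟨⟨φ, -, hφ, hrec⟩, -⟩ := hP
  refine tendsto_order.2 ⟨fun a ha => ?_, fun a ha => limsup_cesaro_le hφ hrec hπ hf x ha⟩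
  have := limsup_cesaro_le hφ hrec hπ hf.neg x (a := -a) (by rw [integral_neg]; linarith)
  filter_upwards [this] with n hn
  rw [cesaro, potential_neg] at hn
  rw [cesaro]
  linarith

/-- The invariant probability measure of a positive Harris recurrent chain is unique. -/
theorem IsPositiveHarris.unique (hP : IsPositiveHarris P) {π π' : Measure X}
    [IsProbabilityMeasure π] [IsProbabilityMeasure π'] (hπ : P.Invariant π)
    (hπ' : P.Invariant π') : π = π' := by
  obtain ⟨x⟩ := nonempty_of_isProbabilityMeasure π
  ext A hA
  have hi := BddMeasurable.indicator_one hA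
  have := tendsto_nhds_unique (hP.tendsto_cesaro hπ hi x) (hP.tendsto_cesaro hπ' hi x)
  simp only [integral_indicator_const _ hA, smul_eq_mul, mul_one] at this
  exact (measureReal_eq_measureReal_iff).1 this

end Ergodic

/-! ### The average cost of a stationary policy -/

section Cost

variable (T : Kernel (X × U) X) [IsMarkovKernel T]

instance (γ : AdmissiblePolicy X U) (x : X) : IsProbabilityMeasure (processLaw T γ x) := by
  unfold processLaw; infer_instance

/-- Under a stationary policy the step forgets all of the history but its last state-action pair,
which reduces the process to the closed-loop chain. -/
lemma transition_stepKernel (γ : StationaryPolicy X U) (t : ℕ) {g : X × U → ℝ}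
    (hg : BddMeasurable g) (h : Finset.Iic t → X × U) :
    transition (stepKernel T γ.toAdmissible t) g h =
      transition T (fun x => g (x, γ.1 x)) (h ⟨t, Finset.mem_Iic.2 le_rfl⟩) := by
  have hm : Measurable (fun p : (Finset.Iic t → X × U) × X => (p.2, γ.toAdmissible.step t p)) :=
    measurable_snd.prodMk (γ.toAdmissible.measurable_step t)
  rw [transition, stepKernel, Kernel.map_apply _ hm, integral_map hm.aemeasurable
    hg.measurable.aestronglyMeasurable, Kernel.prod_apply, Kernel.id_apply, Kernel.comap_apply,
    integral_prod _ ((hg.comp hm).integrable _)]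
  rw [integral_dirac' _ _ (StronglyMeasurable.integral_prod_right
    (hg.comp hm).measurable.stronglyMeasurable)]
  rfl

lemma integral_processLaw (γ : StationaryPolicy X U) (x : X) (t : ℕ) {g : X × U → ℝ}
    (hg : BddMeasurable g) :
    ∫ ω, g (ω t) ∂(processLaw T γ.toAdmissible x) =
      (transition (closedLoop T γ))^[t] (fun x => g (x, γ.1 x)) x := by
  have hm : Measurable fun x => (x, γ.1 x) := measurable_id.prodMk γ.2
  induction t generalizing g with
  | zero => exact integral_traj_zero _ _ hg
  | succ t ih =>
    have h1 : ∫ ω, g (ω (t + 1)) ∂(processLaw T γ.toAdmissible x) =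
        ∫ ω, transition T (fun x => g (x, γ.1 x)) (ω t) ∂(processLaw T γ.toAdmissible x) := by
      refine (integral_traj_succ _ _ t hg).trans (integral_congr_ae (ae_of_all _ fun ω => ?_))
      exact transition_stepKernel T γ t hg _
    rw [h1, ih ((hg.comp hm).transition T), Function.iterate_succ_apply]
    rfl

lemma average_processLaw (γ : StationaryPolicy X U) (x : X) {g : X × U → ℝ}
    (hg : BddMeasurable g) (N : ℕ) :
    (1 / (N : ℝ)) * ∫ ω, ∑ t ∈ Finset.range N, g (ω t) ∂(processLaw T γ.toAdmissible x) =
      cesaro (closedLoop T γ) (fun x => g (x, γ.1 x)) N x := by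
  rw [integral_finsetSum _ fun t _ => (hg.comp (measurable_pi_apply t)).integrable _]
  simp only [integral_processLaw T γ x _ hg]
  rfl

/-- The average cost of a stationary policy is the invariant mean of the cost. -/
theorem avgCost_stationary (γ : StationaryPolicy X U) (hγ : IsPositiveHarris (closedLoop T γ))
    {π : Measure X} [IsProbabilityMeasure π] (hπ : (closedLoop T γ).Invariant π)
    {c : X × U → ℝ} (hc : BddMeasurable c) (x : X) :
    avgCost T c x γ.toAdmissible = ∫ y, c (y, γ.1 y) ∂π := by
  unfold avgCost
  simp only [average_processLaw T γ x hc]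
  exact (hγ.tendsto_cesaro hπ (hc.comp (measurable_id.prodMk γ.2)) x).limsup_eq

/-- Makes the infimum defining `optCost` one over a set bounded below, where it is a genuine lower
bound rather than a default value. -/
lemma neg_le_avgCost {c : X × U → ℝ} {C : ℝ} (hC : ∀ p, |c p| ≤ C) (x : X)
    (γ : AdmissiblePolicy X U) : -C ≤ avgCost T c x γ := by
  have hb : ∀ N : ℕ, |(1 / (N : ℝ)) *
      ∫ ω, ∑ t ∈ Finset.range N, c (ω t) ∂(processLaw T γ x)| ≤ C := by
    intro N
    have hC0 : 0 ≤ C := (abs_nonneg _).trans (hC (x, γ.init x))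
    have h1 := norm_integral_le_of_norm_le_const (μ := processLaw T γ x)
      (f := fun ω : ℕ → X × U => ∑ t ∈ Finset.range N, c (ω t)) (C := N * C)
      (ae_of_all _ fun ω => (Finset.abs_sum_le_sum_abs _ _).trans
        ((Finset.sum_le_card_nsmul _ _ C fun t _ => hC (ω t)).trans (by simp)))
    simp only [probReal_univ, mul_one, Real.norm_eq_abs] at h1
    rcases Nat.eq_zero_or_pos N with rfl | hN
    · simpa using hC0
    · have hN' : (0 : ℝ) < N := by exact_mod_cast hN
      rw [abs_mul, abs_of_pos (by positivity), one_div, inv_mul_le_iff₀ hN']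
      exact h1
  refine le_limsup_of_frequently_le (Frequently.of_forall fun N => (abs_le.1 (hb N)).1)
    ⟨C, ?_⟩
  exact eventually_map.2 (Eventually.of_forall fun N => (abs_le.1 (hb N)).2)

lemma optCost_le {c : X × U → ℝ} (hc : BddMeasurable c) (x : X)
    {Γ : Set (AdmissiblePolicy X U)} {γ : AdmissiblePolicy X U} (hγ : γ ∈ Γ) :
    optCost T c x Γ ≤ avgCost T c x γ := by
  obtain ⟨C, hC⟩ := hc.bounded
  exact ciInf_le ⟨-C, by rintro _ ⟨γ, rfl⟩; exact neg_le_avgCost T hC x γ⟩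
    (⟨γ, hγ⟩ : Γ)

end Cost

end AvgCost

namespace AvgCost

/-! ### Continuous convergence -/

section ContinuousConvergence

/-- Convergence along all convergent sequences of arguments is joint convergence. -/
lemma tendsto_prod_nhds_of_seq {Y Z : Type*} [TopologicalSpace Y] [FirstCountableTopology Y]
    [TopologicalSpace Z] {F : ℕ → Y → Z} {y : Y} {z : Z}
    (h : ∀ q : ℕ → Y, Tendsto q atTop (𝓝 y) → Tendsto (fun n => F n (q n)) atTop (𝓝 z)) :
    Tendsto (fun p : ℕ × Y => F p.1 p.2) (atTop ×ˢ 𝓝 y) (𝓝 z) := by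
  by_contra hnot
  rw [tendsto_def] at hnot
  push Not at hnot
  obtain ⟨V, hV, hbad⟩ := hnot
  obtain ⟨B, hB⟩ := (𝓝 y).exists_antitone_basis
  have hfreq : ∀ k, ∃ᶠ n in atTop, ∃ w ∈ B k, F n w ∉ V := by
    intro k hk
    apply hbad
    have : ∀ᶠ p : ℕ × Y in atTop ×ˢ 𝓝 y, (¬∃ w ∈ B k, F p.1 w ∉ V) ∧ p.2 ∈ B k :=
      hk.prod_mk (hB.1.mem_of_mem trivial)
    filter_upwards [this] with p hp
    by_contra hpV
    exact hp.1 ⟨p.2, hp.2, hpV⟩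
  obtain ⟨ψ, hψ, hw⟩ := extraction_forall_of_frequently hfreq
  choose w hwB hwV using hw
  -- The bad points `w j` are placed at the times `ψ j`, and `y` at all other times, to obtain a
  -- full sequence converging to `y`.
  have hq : Tendsto (Function.extend ψ w fun _ => y) atTop (𝓝 y) := by
    refine hB.1.tendsto_right_iff.2 fun k _ => ?_
    filter_upwards [eventually_ge_atTop (ψ k)] with n hn
    by_cases hex : ∃ j, ψ j = n
    · obtain ⟨j, rfl⟩ := hex
      rw [hψ.injective.extend_apply]
      exact hB.2 (hψ.le_iff_le.1 hn) (hwB j)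
    · rw [Function.extend_apply' _ _ _ hex]
      exact mem_of_mem_nhds (hB.1.mem_of_mem trivial)
  obtain ⟨j, hj⟩ := ((hψ.tendsto_atTop.eventually ((h _ hq).eventually hV))).exists
  rw [hψ.injective.extend_apply] at hj
  exact hwV j hj

/-- A pointwise convergent equicontinuous family converges continuously. -/
lemma tendsto_prod_nhds_of_equicontinuous {ι Y Z : Type*} [TopologicalSpace Y] [UniformSpace Z]
    {l : Filter ι} {F : ι → Y → Z} (hF : Equicontinuous F) {y : Y} {z : Z}
    (h : Tendsto (fun i => F i y) l (𝓝 z)) :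
    Tendsto (fun p : ι × Y => F p.1 p.2) (l ×ˢ 𝓝 y) (𝓝 z) := by
  rw [Uniform.tendsto_nhds_right]
  intro V hV
  obtain ⟨W, hW, hWV⟩ := comp_mem_uniformity_sets hV
  have h1 : ∀ᶠ i in l, (z, F i y) ∈ W := Uniform.tendsto_nhds_right.1 h hW
  refine (h1.prod_mk (hF y W hW)).mono fun p hp => ?_
  exact hWV ⟨F p.1 y, hp.1, hp.2 p.1⟩

end ContinuousConvergence

/-! ### Weak limits of integrals and of invariant measures -/

section WeakConvergence

variable {X : Type*} [MeasurableSpace X] [TopologicalSpace X] [T2Space X] [BorelSpace X]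

/-- Integrals of continuously convergent, uniformly bounded functions against a tight, weakly
convergent family of probability measures converge. -/
lemma tendsto_integral_of_continuousConvergence {ι : Type*} {l : Filter ι}
    {μs : ι → ProbabilityMeasure X} {μ : ProbabilityMeasure X} (hμ : Tendsto μs l (𝓝 μ))
    (ht : IsTightMeasureSet (Set.range fun i => (μs i : Measure X)))
    {F : ι → X → ℝ} {f : X → ℝ}
    (hF : ∀ x, Tendsto (fun p : ι × X => F p.1 p.2) (l ×ˢ 𝓝 x) (𝓝 (f x)))
    (hFm : ∀ i, Measurable (F i)) (hf : Continuous f) {C : ℝ} (hFC : ∀ i x, |F i x| ≤ C)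
    (hfC : ∀ x, |f x| ≤ C) :
    Tendsto (fun i => ∫ x, F i x ∂(μs i : Measure X)) l (𝓝 (∫ x, f x ∂(μ : Measure X))) := by
  have hFb : ∀ i, BddMeasurable (F i) := fun i => ⟨hFm i, C, hFC i⟩
  have hfb : BddMeasurable f := ⟨hf.measurable, C, hfC⟩
  have h1 : Tendsto (fun i => ∫ x, f x ∂(μs i : Measure X)) l (𝓝 (∫ x, f x ∂(μ : Measure X))) :=
    ProbabilityMeasure.tendsto_iff_forall_integral_tendsto.1 hμ
      (BoundedContinuousFunction.ofNormedAddCommGroup f hf C hfC)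
  have h2 : Tendsto (fun i => ∫ x, F i x - f x ∂(μs i : Measure X)) l (𝓝 0) := by
    rw [Metric.tendsto_nhds]
    intro ε hε
    obtain ⟨x₀⟩ := nonempty_of_isProbabilityMeasure (μ : Measure X)
    have hC0 : 0 ≤ C := (abs_nonneg _).trans (hfC x₀)
    -- Outside `K` the integrand is at most `2 * C`, so mass `δ` there costs at most `ε / 2`; the `+
    -- 1` covers `C = 0`.
    set δ : ℝ := ε / (2 * (2 * C + 1)) with hδ
    have hδ0 : 0 < δ := by positivity
    obtain ⟨K, hK, hKm⟩ := isTightMeasureSet_iff_exists_isCompact_measure_compl_le.1 ht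
      (ENNReal.ofReal δ) (ENNReal.ofReal_pos.2 hδ0)
    -- Continuous convergence is locally uniform on `K`, hence uniform by compactness.
    have hunif : TendstoUniformlyOn F f l K := by
      rw [← tendstoLocallyUniformlyOn_iff_tendstoUniformlyOn_of_compact hK]
      refine tendstoLocallyUniformlyOn_iff_forall_tendsto.2 fun x _ => ?_
      have hfx : Tendsto (fun p : ι × X => f p.2) (l ×ˢ 𝓝[K] x) (𝓝 (f x)) :=
        (hf.tendsto x).comp (tendsto_snd.mono_right nhdsWithin_le_nhds)
      exact (hfx.prodMk_nhds ((hF x).mono_left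
        (prod_mono_right _ nhdsWithin_le_nhds))).mono_right (nhds_le_uniformity _)
    filter_upwards [Metric.tendstoUniformlyOn_iff.1 hunif (ε / 4) (by positivity)] with i hi
    have hKc : MeasurableSet Kᶜ := hK.measurableSet.compl
    have hle : ∀ x, |F i x - f x| ≤ ε / 4 + Kᶜ.indicator (fun _ => 2 * C) x := by
      intro x
      by_cases hx : x ∈ K
      · have := hi x hx
        rw [dist_comm, Real.dist_eq] at this
        simpa [hx] using this.le
      · have h3 : |F i x - f x| ≤ C + C := (abs_sub _ _).trans (add_le_add (hFC i x) (hfC x))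
        rw [Set.indicator_of_mem hx]
        linarith
    have hind : Integrable (Kᶜ.indicator fun _ : X => 2 * C) (μs i : Measure X) :=
      (integrable_const _).indicator hKc
    have hint : ∫ x, |F i x - f x| ∂(μs i : Measure X) ≤
        ε / 4 + (μs i : Measure X).real Kᶜ * (2 * C) := by
      refine (integral_mono (((hFb i).sub hfb).integrable _).abs
        ((integrable_const _).add hind) hle).trans (le_of_eq ?_)
      rw [integral_add' (integrable_const _) hind, integral_indicator_const _ hKc]
      simp
    have hreal : (μs i : Measure X).real Kᶜ ≤ δ :=
      ENNReal.toReal_le_of_le_ofReal hδ0.le (hKm _ ⟨i, rfl⟩)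
    have hδC : δ * (2 * C) ≤ ε / 2 := by
      have : δ * (2 * C + 1) = ε / 2 := by
        rw [hδ]
        field_simp
      nlinarith
    rw [dist_zero_right]
    calc ‖∫ x, F i x - f x ∂(μs i : Measure X)‖ ≤ ∫ x, |F i x - f x| ∂(μs i : Measure X) :=
          norm_integral_le_integral_norm _
      _ ≤ ε / 4 + (μs i : Measure X).real Kᶜ * (2 * C) := hint
      _ ≤ ε / 4 + δ * (2 * C) := by gcongr
      _ < ε := by linarith
  have h3 := h2.add h1
  rw [zero_add] at h3
  refine h3.congr fun i => ?_
  rw [integral_sub ((hFb i).integrable _) (hfb.integrable _), sub_add_cancel]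

variable [HasOuterApproxClosed X]

/-- Stability of the invariant measure: under continuous convergence of the kernels and
tightness, the invariant measures converge to the unique invariant measure of the limit. -/
lemma tendsto_of_invariant {ι : Type*} {l : Ultrafilter ι} {Ps : ι → Kernel X X}
    [∀ i, IsMarkovKernel (Ps i)] {P : Kernel X X} [IsMarkovKernel P]
    (hP : ∀ x, Tendsto (fun p : ι × X => kernelAt (Ps p.1) p.2) (l ×ˢ 𝓝 x) (𝓝 (kernelAt P x)))
    (hPc : Continuous (kernelAt P))
    {πs : ι → ProbabilityMeasure X} (hπs : ∀ i, (Ps i).Invariant (πs i : Measure X))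
    (ht : IsTightMeasureSet (Set.range fun i => (πs i : Measure X)))
    {π : ProbabilityMeasure X}
    (huniq : ∀ ν : ProbabilityMeasure X, P.Invariant (ν : Measure X) → ν = π) :
    Tendsto πs l (𝓝 π) := by
  -- Prokhorov's theorem: the ultrafilter then has a limit `ν`, and only the invariance of `ν`
  -- remains to be shown.
  have hcomp : IsCompact (closure (Set.range πs)) := by
    apply isCompact_closure_of_isTightMeasureSet
    convert ht using 1
    ext ν
    simp
  obtain ⟨ν, -, hν⟩ := hcomp.ultrafilter_le_nhds (l.map πs)
    (le_principal_iff.2 (Ultrafilter.mem_map.2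
      (Filter.univ_mem' fun i => subset_closure ⟨i, rfl⟩)))
  have hν' : Tendsto πs l (𝓝 ν) := hν
  suffices hinv : P.Invariant (ν : Measure X) by rwa [huniq ν hinv] at hν'
  refine ext_of_forall_integral_eq_of_IsFiniteMeasure fun f => ?_
  have hfb : BddMeasurable f := ⟨f.continuous.measurable, ‖f‖, f.norm_coe_le_norm⟩
  rw [← integral_transition P hfb]
  -- By invariance of `πs i` these integrals are those of `f`, which tend to the integral of `f`
  -- against `ν`; comparing the two limits shows that `ν` is invariant.
  have h1 : Tendsto (fun i => ∫ x, transition (Ps i) f x ∂(πs i : Measure X)) l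
      (𝓝 (∫ x, transition P f x ∂(ν : Measure X))) := by
    refine tendsto_integral_of_continuousConvergence hν' ht (fun x => ?_)
      (fun i => (hfb.transition (Ps i)).measurable) ?_
      (fun i => abs_iterate_transition_le (Ps i) f.norm_coe_le_norm 1)
      (abs_iterate_transition_le P f.norm_coe_le_norm 1)
    · exact ProbabilityMeasure.tendsto_iff_forall_integral_tendsto.1 (hP x) f
    · refine continuous_iff_continuousAt.2 fun x => ?_
      exact ProbabilityMeasure.tendsto_iff_forall_integral_tendsto.1 (hPc.tendsto x) f
  simp only [integral_transition_of_invariant _ hfb (hπs _)] at h1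
  exact tendsto_nhds_unique h1 (ProbabilityMeasure.tendsto_iff_forall_integral_tendsto.1 hν' f)

end WeakConvergence

/-! ### Stability of the average cost of stationary policies -/

section Stability

variable {X U : Type*} [MeasurableSpace X] [TopologicalSpace X] [T2Space X] [BorelSpace X]
  [HasOuterApproxClosed X]
  [MeasurableSpace U] [UniformSpace U] [BorelSpace U] [SecondCountableTopology U]

/-- Along an ultrafilter, the average cost is continuous in the kernel and the stationary policy,
for continuous convergence of both. -/
lemma tendsto_avgCost {ι : Type*} {l : Ultrafilter ι} {Ts : ι → Kernel (X × U) X}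
    [∀ i, IsMarkovKernel (Ts i)] {T : Kernel (X × U) X} [IsMarkovKernel T]
    (hTs : ∀ p, Tendsto (fun q : ι × (X × U) => kernelAt (Ts q.1) q.2) (l ×ˢ 𝓝 p)
      (𝓝 (kernelAt T p)))
    (hT : Continuous (kernelAt T))
    {γs : ι → StationaryPolicy X U} {γ : StationaryPolicy X U}
    (hγs : ∀ x, Tendsto (fun p : ι × X => (γs p.1).1 p.2) (l ×ˢ 𝓝 x) (𝓝 (γ.1 x)))
    (hγ : Continuous γ.1)
    (hHs : ∀ i, IsPositiveHarris (closedLoop (Ts i) (γs i)))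
    (hH : IsPositiveHarris (closedLoop T γ))
    (ht : IsTightMeasureSet (⋃ i, invariantMeasures (Ts i)))
    {c : X × U → ℝ} (hc : Continuous c) {C : ℝ} (hC : ∀ p, |c p| ≤ C) (x₀ : X) :
    Tendsto (fun i => avgCost (Ts i) c x₀ (γs i).toAdmissible) l
      (𝓝 (avgCost T c x₀ γ.toAdmissible)) := by
  have hcb : BddMeasurable c := ⟨hc.measurable, C, hC⟩
  have hpair : ∀ x, Tendsto (fun p : ι × X => (p.2, (γs p.1).1 p.2)) (l ×ˢ 𝓝 x)
      (𝓝 (x, γ.1 x)) := fun x => tendsto_snd.prodMk_nhds (hγs x)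
  have hex : ∀ i, ∃ π : ProbabilityMeasure X,
      (closedLoop (Ts i) (γs i)).Invariant (π : Measure X) := fun i => by
    obtain ⟨π, hπ, hinv⟩ := (hHs i).2
    exact ⟨⟨π, hπ⟩, hinv⟩
  choose πs hinvs using hex
  obtain ⟨π, hinv⟩ : ∃ π : ProbabilityMeasure X, (closedLoop T γ).Invariant (π : Measure X) := by
    obtain ⟨π, hπ, hinv⟩ := hH.2
    exact ⟨⟨π, hπ⟩, hinv⟩
  have htight : IsTightMeasureSet (Set.range fun i => (πs i : Measure X)) := by
    refine ht.subset ?_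
    rintro _ ⟨i, rfl⟩
    exact Set.mem_iUnion.2 ⟨i, inferInstance, γs i, hinvs i⟩
  have hlim : Tendsto πs l (𝓝 π) := by
    refine tendsto_of_invariant (Ps := fun i => closedLoop (Ts i) (γs i)) (P := closedLoop T γ)
      (fun x => ?_) ?_ hinvs htight ?_
    · exact (hTs (x, γ.1 x)).comp (tendsto_fst.prodMk (hpair x))
    · exact hT.comp (continuous_id.prodMk hγ)
    · intro ν hν
      exact Subtype.ext (hH.unique (π := (ν : Measure X)) (π' := (π : Measure X)) hν hinv)
  simp only [avgCost_stationary _ _ (hHs _) (hinvs _) hcb, avgCost_stationary T γ hH hinv hcb]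
  exact tendsto_integral_of_continuousConvergence hlim htight
    (fun x => (hc.tendsto _).comp (hpair x))
    (fun i => hcb.measurable.comp (measurable_id.prodMk (γs i).2))
    (hc.comp (continuous_id.prodMk hγ)) (fun i x => hC _) fun x => hC _

omit [T2Space X] [HasOuterApproxClosed X] [SecondCountableTopology U] in
/-- An equicontinuous family of policies with values in a compact space converges along every
ultrafilter. -/
lemma exists_continuous_limit_policy [CompactSpace U] {ι : Type*} (l : Ultrafilter ι)
    {γs : ι → StationaryPolicy X U} (hγs : Equicontinuous fun i => (γs i).1) :
    ∃ γ : StationaryPolicy X U, Continuous γ.1 ∧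
      ∀ x, Tendsto (fun p : ι × X => (γs p.1).1 p.2) (l ×ˢ 𝓝 x) (𝓝 (γ.1 x)) := by
  have hex : ∀ x, ∃ u, Tendsto (fun i => (γs i).1 x) l (𝓝 u) := fun x => by
    obtain ⟨u, -, hu⟩ := isCompact_univ.ultrafilter_le_nhds (l.map fun i => (γs i).1 x) (by simp)
    exact ⟨u, hu⟩
  choose g hg using hex
  -- Equicontinuity passes to the pointwise limit; continuity also supplies the measurability that
  -- makes `g` a policy.
  have hgc : Continuous g :=
    Filter.Tendsto.continuous_of_equicontinuous (l := (l : Filter ι)) (tendsto_pi_nhds.2 hg) hγs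
  exact ⟨⟨g, hgc.measurable⟩, hgc, fun x => tendsto_prod_nhds_of_equicontinuous hγs (hg x)⟩

end Stability

end AvgCost

/-! ### Convergence of optimal costs and robustness -/

theorem mainTheorem5 {d m : ℕ}
    (X : Set (EuclideanSpace ℝ (Fin d))) (_hX : MeasurableSet X)
    (U : Set (EuclideanSpace ℝ (Fin m))) (hU : IsCompact U)
    (c : X × U → ℝ) (hc : Continuous c) (hcb : ∃ C : ℝ, ∀ p, |c p| ≤ C)
    (T : Kernel (X × U) X) [IsMarkovKernel T]
    (Tn : ℕ → Kernel (X × U) X) [∀ n, IsMarkovKernel (Tn n)]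
    -- weak continuity of the kernels in the state and the action
    (hT : Continuous (AvgCost.kernelAt T))
    (hTn : ∀ n, Continuous (AvgCost.kernelAt (Tn n)))
    -- continuous weak convergence of the kernels
    (hconv : ∀ (p : X × U) (q : ℕ → X × U), Tendsto q atTop (𝓝 p) →
      Tendsto (fun n => AvgCost.kernelAt (Tn n) (q n)) atTop (𝓝 (AvgCost.kernelAt T p)))
    -- positive Harris recurrence under every stationary policy
    (hHarris : ∀ γ : AvgCost.StationaryPolicy X U,
      AvgCost.IsPositiveHarris (AvgCost.closedLoop T γ))
    (hHarrisn : ∀ n, ∀ γ : AvgCost.StationaryPolicy X U,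
      AvgCost.IsPositiveHarris (AvgCost.closedLoop (Tn n) γ))
    -- tightness of the families of invariant measures
    (htight : IsTightMeasureSet (AvgCost.invariantMeasures T))
    (htightn : IsTightMeasureSet (⋃ n, AvgCost.invariantMeasures (Tn n)))
    -- the initial state and the class of policies over which the cost is minimized
    (x₀ : X) (Γ : Set (AvgCost.AdmissiblePolicy X U))
    (hΓ : ∀ γ : AvgCost.StationaryPolicy X U, γ.toAdmissible ∈ Γ)
    -- optimal stationary policies
    (γs : AvgCost.StationaryPolicy X U) (γn : ℕ → AvgCost.StationaryPolicy X U)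
    (hγs : AvgCost.avgCost T c x₀ γs.toAdmissible = AvgCost.optCost T c x₀ Γ)
    (hγn : ∀ n, AvgCost.avgCost (Tn n) c x₀ (γn n).toAdmissible
      = AvgCost.optCost (Tn n) c x₀ Γ)
    (hγs_cont : Continuous γs.1)
    (hγn_equi : Equicontinuous (fun n => (γn n).1)) :
    Tendsto (fun n => AvgCost.optCost (Tn n) c x₀ Γ) atTop (𝓝 (AvgCost.optCost T c x₀ Γ)) ∧
    Tendsto (fun n => AvgCost.avgCost T c x₀ (γn n).toAdmissible) atTop
      (𝓝 (AvgCost.optCost T c x₀ Γ)) := by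
  obtain ⟨C, hC⟩ := hcb
  have hcm : AvgCost.BddMeasurable c := ⟨hc.measurable, C, hC⟩
  have : CompactSpace U := isCompact_iff_compactSpace.1 hU
  have hjoint : ∀ p, Tendsto (fun q : ℕ × (X × U) => AvgCost.kernelAt (Tn q.1) q.2)
      (atTop ×ˢ 𝓝 p) (𝓝 (AvgCost.kernelAt T p)) := fun p =>
    AvgCost.tendsto_prod_nhds_of_seq (F := fun n => AvgCost.kernelAt (Tn n)) (hconv p)
  -- The limit policy may depend on `l`, but the limit of the costs does not.
  suffices key : ∀ l : Ultrafilter ℕ, (l : Filter ℕ) ≤ atTop →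
      Tendsto (fun n => AvgCost.optCost (Tn n) c x₀ Γ) l (𝓝 (AvgCost.optCost T c x₀ Γ)) ∧
      Tendsto (fun n => AvgCost.avgCost T c x₀ (γn n).toAdmissible) l
        (𝓝 (AvgCost.optCost T c x₀ Γ)) from
    ⟨(tendsto_iff_ultrafilter _ _ _).2 fun l hl => (key l hl).1,
      (tendsto_iff_ultrafilter _ _ _).2 fun l hl => (key l hl).2⟩
  intro l hl
  have hjl := fun p => (hjoint p).mono_left (prod_mono_left (𝓝 p) hl)
  obtain ⟨γ, hγc, hγ⟩ := AvgCost.exists_continuous_limit_policy l hγn_equi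
  -- Three limits are needed: kernels and policies both moving, kernels moving under the fixed `γs`,
  -- and the fixed `T` under moving policies. The limit `γ` need not be `γs`, so recurrence is used
  -- for it too.
  have h1 := AvgCost.tendsto_avgCost hjl hT hγ hγc (fun n => hHarrisn n (γn n)) (hHarris γ)
    htightn hc hC x₀
  have h2 := AvgCost.tendsto_avgCost (γs := fun _ => γs) hjl hT
    (fun x => (hγs_cont.tendsto x).comp tendsto_snd) hγs_cont (fun n => hHarrisn n γs)
    (hHarris γs) htightn hc hC x₀
  have h3 := AvgCost.tendsto_avgCost (Ts := fun _ : ℕ => T) (l := l)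
    (fun p => (hT.tendsto p).comp tendsto_snd) hT hγ hγc (fun n => hHarris (γn n)) (hHarris γ)
    (by rwa [Set.iUnion_const]) hc hC x₀
  -- For each `n`, `γn n` costs no more than `γs` under `Tn n`; in the limit `γ` costs no more than
  -- `γs` under `T`.
  have hopt : AvgCost.avgCost T c x₀ γ.toAdmissible = AvgCost.optCost T c x₀ Γ := by
    refine le_antisymm ?_ (AvgCost.optCost_le T hcm x₀ (hΓ γ))
    rw [← hγs]
    refine le_of_tendsto_of_tendsto' h1 h2 fun n => ?_
    rw [hγn n]
    exact AvgCost.optCost_le (Tn n) hcm x₀ (hΓ γs)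
  rw [hopt] at h1 h3
  exact ⟨h1.congr hγn, h3⟩
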